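/- Let $m\ge 1$ be an integer, let $c_1<c_2$ be real numbers with $c_2>0$, and let $\zeta>0$. Consider the non-contextual pricing problem: in each of $T$ rounds $t=1,\dots,T$ the seller posts a price $p_t\ge 0$, chosen (possibly at random) on the basis of the past prices and sale outcomes $p_1,y_1,\dots,p_{t-1},y_{t-1}$, and then observes the sale outcome $y_t\in\{0,1\}$, which given the past and $p_t$ is Bernoulli with parameter $1-F(p_t)$. Here $F$ is the cumulative distribution function, unknown to the seller, of a probability distribution on $\mathbb{R}$. Let $\mathrm{Rev}(x)=x(1-F(x))$, and let $$\mathbb{E}[\mathrm{Reg}(T)]=\mathbb{E}\Big[\sum_{t=1}^{T}\Big(\sup_{p\ge 0}\mathrm{Rev}(p)-\mathrm{Rev}(p_t)\Big)\Big]$$ be the expected regret over $T$ rounds. Let $\mathcal{F}$ be the set of all such $F$ (thus $F$ is nondecreasing, right-continuous and takes values in $[0,1]$) for which 1. $F$ is $m$ times differentiable on $[c_1,c_2]$ (with one-sided derivatives at the end points), and 2. $\mathrm{Rev}$ has a unique maximizer, and this maximizer lies in $[c_1,c_2]$. Then no policy achieves regret $\mathcal{O}\bigl(T^{\frac{m+1}{2m+1}-\zeta}\bigr)$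 on $\mathcal{F}$, not even with a constant that depends on $F$: for every policy, including those that know $T$ in advance and are chosen separately for each $T$, there is an $F\in\mathcal{F}$ for which $\mathbb{E}[\mathrm{Reg}(T)]$ is not $\mathcal{O}\bigl(T^{\frac{m+1}{2m+1}-\zeta}\bigr)$ as $T\to\infty$. -/

import Mathlib

open MeasureTheory ProbabilityTheory Filter Asymptotics
open scoped NNReal ENNReal Topology

namespace Pricing

/-- `f` is `m` times differentiable on `s`: each of its derivatives of order `0, …, m - 1`
(taken within `s`, so one-sided at the end points of an interval) is differentiable on `s`. -/
def TimesDifferentiableOn (m : ℕ) (f : ℝ → ℝ) (s : Set ℝ) : Prop :=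
  ∀ k < m, DifferentiableOn ℝ (iteratedDerivWithin k f s) s

/-- The expected revenue `x (1 - F x)` of the price `x`, where `F` is the cumulative distribution
function of `ν`. -/
noncomputable def revenue (ν : Measure ℝ) (x : ℝ) : ℝ := x * (1 - cdf ν x)

/-- The market conditions: the cumulative distribution function `F` of `ν` (nondecreasing,
right-continuous and `[0,1]`-valued, as every such function) is `m` times differentiable on
`[c₁, c₂]`, and `x ↦ x (1 - F x)` has a unique maximizer, which lies in `[c₁, c₂]`. -/
structure IsMarket (m : ℕ) (c₁ c₂ : ℝ) (ν : Measure ℝ) : Prop where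
  differentiable : TimesDifferentiableOn m (cdf ν) (Set.Icc c₁ c₂)
  unique_maximizer : ∃ x ∈ Set.Icc c₁ c₂, ∀ y : ℝ, y ≠ x → revenue ν y < revenue ν x

/-- The observations of the first `n` rounds: the posted prices, and whether a sale occurred. -/
abbrev History (n : ℕ) : Type := Fin n → ℝ≥0 × Bool

/-- A (possibly randomized) pricing policy: after `n` rounds, the next price is drawn from a
distribution that depends measurably on the observations made so far. -/
structure Policy where
  price : (n : ℕ) → Kernel (History n) ℝ≥0
  isMarkov : ∀ n, IsMarkovKernel (price n)

instance (φ : Policy) (n : ℕ) : IsMarkovKernel (φ.price n) := φ.isMarkov n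

/-- The sale outcome at price `p`, a Bernoulli variable with parameter `1 - F p`. -/
noncomputable def sale (ν : Measure ℝ) : Kernel ℝ≥0 Bool where
  toFun p := ENNReal.ofReal (1 - cdf ν p) • Measure.dirac true
    + ENNReal.ofReal (cdf ν p) • Measure.dirac false
  measurable' := by
    have hF : Measurable fun p : ℝ≥0 => cdf ν (p : ℝ) :=
      (monotone_cdf ν).measurable.comp measurable_coe_nnreal_real
    refine Measure.measurable_of_measurable_coe _ fun s _ => ?_
    simp only [Measure.coe_add, Measure.coe_smul, Pi.add_apply, Pi.smul_apply, smul_eq_mul]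
    fun_prop

instance (ν : Measure ℝ) : IsMarkovKernel (sale ν) where
  isProbabilityMeasure p := ⟨by
    change (ENNReal.ofReal (1 - cdf ν p) • Measure.dirac true
      + ENNReal.ofReal (cdf ν p) • Measure.dirac false : Measure Bool) Set.univ = 1
    simp only [Measure.coe_add, Measure.coe_smul, Pi.add_apply, Pi.smul_apply, smul_eq_mul,
      measure_univ, mul_one]
    rw [← ENNReal.ofReal_add (sub_nonneg.2 (cdf_le_one ν _)) (cdf_nonneg ν _)]
    simp⟩

/-- The conditional law of (price, sale outcome) in the round after the first `n` rounds, given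
the observations of these. -/
noncomputable def step (φ : Policy) (ν : Measure ℝ) (n : ℕ) : Kernel (History n) (ℝ≥0 × Bool) :=
  φ.price n ⊗ₖ Kernel.prodMkLeft (History n) (sale ν)

instance (φ : Policy) (ν : Measure ℝ) (n : ℕ) : IsMarkovKernel (step φ ν n) := by
  unfold step; infer_instance

/-- Append the observation of one more round. -/
def History.append {n : ℕ} (q : History n × (ℝ≥0 × Bool)) : History (n + 1) :=
  Fin.snoc (α := fun _ => ℝ≥0 × Bool) q.1 q.2

theorem History.measurable_append {n : ℕ} :
    Measurable (History.append : History n × (ℝ≥0 × Bool) → History (n + 1)) := by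
  refine measurable_pi_iff.2 fun i => ?_
  refine Fin.lastCases ?_ (fun j => ?_) i
  · simpa [History.append] using measurable_snd
  · have h : Measurable fun q : History n × (ℝ≥0 × Bool) => q.1 j :=
      (measurable_pi_apply j).comp measurable_fst
    simpa [History.append] using h

/-- The law of the observations of the first `n` rounds under the policy `φ`. -/
noncomputable def law (φ : Policy) (ν : Measure ℝ) : (n : ℕ) → Measure (History n)
  | 0 => Measure.dirac Fin.elim0
  | n + 1 => (law φ ν n ⊗ₘ step φ ν n).map History.append

instance (φ : Policy) (ν : Measure ℝ) (n : ℕ) : IsProbabilityMeasure (law φ ν n) := by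
  induction n with
  | zero => unfold law; infer_instance
  | succ n ih =>
    unfold law
    exact Measure.isProbabilityMeasure_map History.measurable_append.aemeasurable

/-- The revenue of an optimal price (a supremum which is attained if `IsMarket m c₁ c₂ ν`). -/
noncomputable def optimalRevenue (ν : Measure ℝ) : ℝ := ⨆ p : ℝ≥0, revenue ν p

/-- The expected cumulative regret of the policy `φ` over `T` rounds. -/
noncomputable def expectedRegret (φ : Policy) (ν : Measure ℝ) (T : ℕ) : ℝ :=
  ∫ h, ∑ t, (optimalRevenue ν - revenue ν (h t).1) ∂law φ ν T

end Pricing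

namespace Pricing

theorem integrable_of_abs_le {α : Type*} [MeasurableSpace α] {μ : Measure α} [IsFiniteMeasure μ]
    {f : α → ℝ} (hf : Measurable f) {C : ℝ} (hC : ∀ a, |f a| ≤ C) : Integrable f μ :=
  Integrable.of_bound hf.aestronglyMeasurable C (.of_forall hC)

theorem integral_sale (ν : Measure ℝ) (p : ℝ≥0) (f : Bool → ℝ) :
    ∫ y, f y ∂sale ν p = (1 - cdf ν p) * f true + cdf ν p * f false := by
  have h (b : Bool) : Integrable f (Measure.dirac b : Measure Bool) := .of_finite
  change ∫ y, f y ∂(ENNReal.ofReal (1 - cdf ν p) • Measure.dirac true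
    + ENNReal.ofReal (cdf ν p) • Measure.dirac false : Measure Bool) = _
  rw [integral_add_measure ((h _).smul_measure ENNReal.ofReal_ne_top)
    ((h _).smul_measure ENNReal.ofReal_ne_top), integral_smul_measure, integral_smul_measure,
    integral_dirac, integral_dirac, ENNReal.toReal_ofReal (sub_nonneg.2 (cdf_le_one ν _)),
    ENNReal.toReal_ofReal (cdf_nonneg ν _), smul_eq_mul, smul_eq_mul]

theorem integral_step (φ : Policy) (ν : Measure ℝ) {n : ℕ} (h : History n) {f : ℝ≥0 × Bool → ℝ}
    (hf : Measurable f) {C : ℝ} (hC : ∀ q, |f q| ≤ C) :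
    ∫ q, f q ∂step φ ν n h = ∫ p, ∫ y, f (p, y) ∂sale ν p ∂φ.price n h := by
  have hi : Integrable f ((φ.price n ⊗ₖ Kernel.prodMkLeft (History n) (sale ν)) h) :=
    integrable_of_abs_le hf hC
  rw [step, ProbabilityTheory.integral_compProd hi]
  rfl

theorem integral_law_succ (φ : Policy) (ν : Measure ℝ) {n : ℕ} {f : History (n + 1) → ℝ}
    (hf : Measurable f) {C : ℝ} (hC : ∀ h, |f h| ≤ C) :
    ∫ h, f h ∂law φ ν (n + 1) =
      ∫ h, ∫ q, f (History.append (h, q)) ∂step φ ν n h ∂law φ ν n := by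
  rw [law, integral_map History.measurable_append.aemeasurable hf.aestronglyMeasurable,
    Measure.integral_compProd]
  exact integrable_of_abs_le (hf.comp History.measurable_append) fun q => hC _

theorem History.append_castSucc {n : ℕ} (h : History n) (q : ℝ≥0 × Bool) (i : Fin n) :
    History.append (h, q) i.castSucc = h i := by
  simp [History.append]

theorem History.append_last {n : ℕ} (h : History n) (q : ℝ≥0 × Bool) :
    History.append (h, q) (Fin.last n) = q := by
  simp [History.append]

/-- The relative change of the probability of a sale outcome when `ν₀` is replaced by `ν`. -/
noncomputable def score (ν₀ ν : Measure ℝ) (q : ℝ≥0 × Bool) : ℝ :=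
  bif q.2 then (cdf ν₀ q.1 - cdf ν q.1) / (1 - cdf ν₀ q.1)
  else (cdf ν q.1 - cdf ν₀ q.1) / cdf ν₀ q.1

theorem measurable_cdf_coe (ν : Measure ℝ) : Measurable fun p : ℝ≥0 => cdf ν (p : ℝ) :=
  (monotone_cdf ν).measurable.comp measurable_coe_nnreal_real

theorem measurable_score (ν₀ ν : Measure ℝ) : Measurable (score ν₀ ν) := by
  have h₀ := measurable_cdf_coe ν₀
  have h := measurable_cdf_coe ν
  refine measurable_from_prod_countable_left fun y => ?_
  cases y
  · simp only [score, cond_false]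
    fun_prop
  · simp only [score, cond_true]
    fun_prop

/-- The number of prices in `J`. -/
noncomputable def visits (J : Set ℝ) {n : ℕ} (h : History n) : ℝ :=
  ∑ t, J.indicator 1 ((h t).1 : ℝ)

theorem measurable_visits {J : Set ℝ} (hJ : MeasurableSet J) (n : ℕ) :
    Measurable (visits J : History n → ℝ) := by
  have : Measurable (J.indicator (1 : ℝ → ℝ)) := measurable_one.indicator hJ
  unfold visits
  fun_prop

theorem indicator_one_mem (J : Set ℝ) (x : ℝ) :
    0 ≤ J.indicator (1 : ℝ → ℝ) x ∧ J.indicator (1 : ℝ → ℝ) x ≤ 1 := by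
  by_cases h : x ∈ J <;> simp [h]

theorem visits_nonneg (J : Set ℝ) {n : ℕ} (h : History n) : 0 ≤ visits J h :=
  Finset.sum_nonneg fun _ _ => (indicator_one_mem J _).1

theorem visits_le (J : Set ℝ) {n : ℕ} (h : History n) : visits J h ≤ n := by
  refine (Finset.sum_le_sum fun t _ => (indicator_one_mem J ((h t).1 : ℝ)).2).trans ?_
  simp

theorem integrable_visits {J : Set ℝ} (hJ : MeasurableSet J) {n : ℕ} (μ : Measure (History n))
    [IsFiniteMeasure μ] : Integrable (visits J) μ :=
  integrable_of_abs_le (measurable_visits hJ n) fun h => by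
    rw [abs_of_nonneg (visits_nonneg J h)]; exact visits_le J h

/-- The market `ν` differs from `ν₀` only for prices in `J`, and there by at most `η`, while the
probabilities of both sale outcomes are at least `δ` under `ν₀`. -/
structure Perturbation (ν₀ ν : Measure ℝ) (J : Set ℝ) (δ η : ℝ) : Prop where
  eq_off : ∀ p ∉ J, cdf ν p = cdf ν₀ p
  abs_sub_le : ∀ p ∈ J, |cdf ν p - cdf ν₀ p| ≤ η
  le_cdf : ∀ p ∈ J, δ ≤ cdf ν₀ p
  le_one_sub_cdf : ∀ p ∈ J, δ ≤ 1 - cdf ν₀ p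

section

variable {ν₀ ν : Measure ℝ} {J : Set ℝ} {δ η : ℝ}

theorem Perturbation.abs_score_le (hp : Perturbation ν₀ ν J δ η) (hδ : 0 < δ)
    (q : ℝ≥0 × Bool) : |score ν₀ ν q| ≤ η / δ * J.indicator 1 (q.1 : ℝ) := by
  obtain ⟨p, y⟩ := q
  by_cases h : (p : ℝ) ∈ J
  · have h1 := hp.abs_sub_le _ h
    have h2 := hp.le_cdf _ h
    have h3 := hp.le_one_sub_cdf _ h
    have h0 : 0 ≤ η := (abs_nonneg _).trans h1
    cases y
    · simp only [score, cond_false, h, Set.indicator_of_mem, Pi.one_apply, mul_one, abs_div]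
      rw [abs_of_pos (hδ.trans_le h2)]
      gcongr
    · simp only [score, cond_true, h, Set.indicator_of_mem, Pi.one_apply, mul_one, abs_div]
      rw [abs_of_pos (hδ.trans_le h3), abs_sub_comm]
      gcongr
  · cases y <;> simp [score, h, hp.eq_off _ h]

theorem Perturbation.integral_sale_eq (hp : Perturbation ν₀ ν J δ η) (hδ : 0 < δ) (p : ℝ≥0)
    (f : Bool → ℝ) :
    ∫ y, f y ∂sale ν p = ∫ y, f y * (1 + score ν₀ ν (p, y)) ∂sale ν₀ p := by
  rw [integral_sale, integral_sale]
  simp only [score, cond_true, cond_false]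
  by_cases h : (p : ℝ) ∈ J
  · have h2 := hδ.trans_le (hp.le_cdf _ h)
    have h3 := hδ.trans_le (hp.le_one_sub_cdf _ h)
    field_simp
    ring
  · simp [hp.eq_off _ h]

theorem Perturbation.integral_sale_score (hp : Perturbation ν₀ ν J δ η) (hδ : 0 < δ) (p : ℝ≥0) :
    ∫ y, score ν₀ ν (p, y) ∂sale ν₀ p = 0 := by
  rw [integral_sale]
  simp only [score, cond_true, cond_false]
  by_cases h : (p : ℝ) ∈ J
  · have h2 := hδ.trans_le (hp.le_cdf _ h)
    have h3 := hδ.trans_le (hp.le_one_sub_cdf _ h)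
    field_simp
    ring
  · simp [hp.eq_off _ h]

theorem Perturbation.abs_score_le_half (hp : Perturbation ν₀ ν J δ η) (hδ : 0 < δ)
    (hη : 0 ≤ η) (hηδ : η ≤ δ / 2) (q : ℝ≥0 × Bool) : |score ν₀ ν q| ≤ 1 / 2 := by
  have h2 : η / δ ≤ 1 / 2 := by rw [div_le_iff₀ hδ]; linarith
  have h3 := indicator_one_mem J (q.1 : ℝ)
  have h4 : 0 ≤ η / δ := by positivity
  exact (hp.abs_score_le hδ q).trans (by nlinarith)

/-- The likelihood ratio of the observations. -/
noncomputable def likelihood (ν₀ ν : Measure ℝ) {n : ℕ} (h : History n) : ℝ :=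
  ∏ t, (1 + score ν₀ ν (h t))

/-- The sum of the scores of the observations. -/
noncomputable def scoreSum (ν₀ ν : Measure ℝ) {n : ℕ} (h : History n) : ℝ :=
  ∑ t, score ν₀ ν (h t)

/-- The sum of the squared scores of the observations. -/
noncomputable def scoreSqSum (ν₀ ν : Measure ℝ) {n : ℕ} (h : History n) : ℝ :=
  ∑ t, score ν₀ ν (h t) ^ 2

theorem measurable_likelihood (ν₀ ν : Measure ℝ) (n : ℕ) :
    Measurable (likelihood ν₀ ν : History n → ℝ) := by
  have := measurable_score ν₀ ν
  unfold likelihood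
  fun_prop

theorem measurable_scoreSum (ν₀ ν : Measure ℝ) (n : ℕ) :
    Measurable (scoreSum ν₀ ν : History n → ℝ) := by
  have := measurable_score ν₀ ν
  unfold scoreSum
  fun_prop

theorem measurable_scoreSqSum (ν₀ ν : Measure ℝ) (n : ℕ) :
    Measurable (scoreSqSum ν₀ ν : History n → ℝ) := by
  have := measurable_score ν₀ ν
  unfold scoreSqSum
  fun_prop

theorem abs_likelihood_le (hs : ∀ q, |score ν₀ ν q| ≤ 1 / 2)
    {n : ℕ} (h : History n) : |likelihood ν₀ ν h| ≤ 2 ^ n := by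
  rw [likelihood, Finset.abs_prod]
  refine (Finset.prod_le_prod (fun _ _ => abs_nonneg _) (g := fun _ => (2 : ℝ)) fun t _ => ?_).trans
    (by simp)
  have := abs_le.1 (hs (h t))
  rw [abs_le]
  constructor <;> linarith

theorem abs_scoreSum_le (hs : ∀ q, |score ν₀ ν q| ≤ 1 / 2)
    {n : ℕ} (h : History n) : |scoreSum ν₀ ν h| ≤ n := by
  refine (Finset.abs_sum_le_sum_abs _ _).trans ?_
  refine (Finset.sum_le_sum (g := fun _ => (1 : ℝ)) fun t _ => ?_).trans (by simp)
  linarith [hs (h t)]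

theorem abs_scoreSqSum_le (hs : ∀ q, |score ν₀ ν q| ≤ 1 / 2)
    {n : ℕ} (h : History n) : |scoreSqSum ν₀ ν h| ≤ n := by
  refine (Finset.abs_sum_le_sum_abs _ _).trans ?_
  refine (Finset.sum_le_sum (g := fun _ => (1 : ℝ)) fun t _ => ?_).trans (by simp)
  rw [abs_pow]
  nlinarith [hs (h t), abs_nonneg (score ν₀ ν (h t))]

theorem le_likelihood (hs : ∀ q, |score ν₀ ν q| ≤ 1 / 2)
    {n : ℕ} (h : History n) :
    1 + scoreSum ν₀ ν h - 2 * scoreSqSum ν₀ ν h ≤ likelihood ν₀ ν h := by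
  have key (t : Fin n) : Real.exp (score ν₀ ν (h t) - 2 * score ν₀ ν (h t) ^ 2) ≤
      1 + score ν₀ ν (h t) := by
    set x := score ν₀ ν (h t)
    have hx := abs_le.1 (hs (h t))
    have h0 : 0 < 1 + x := by linarith [hx.1]
    rw [← Real.le_log_iff_exp_le h0]
    refine le_trans ?_ (Real.one_sub_inv_le_log_of_pos h0)
    have : (1 + x)⁻¹ ≤ 1 - x + 2 * x ^ 2 := by
      rw [inv_le_iff_one_le_mul₀ h0]
      nlinarith [sq_nonneg x, mul_nonneg (sq_nonneg x) (by linarith [hx.1] : 0 ≤ 1 + 2 * x)]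
    linarith
  have h1 : Real.exp (scoreSum ν₀ ν h - 2 * scoreSqSum ν₀ ν h) ≤ likelihood ν₀ ν h := by
    rw [scoreSum, scoreSqSum, Finset.mul_sum, ← Finset.sum_sub_distrib, Real.exp_sum]
    exact Finset.prod_le_prod (fun _ _ => (Real.exp_pos _).le) fun t _ => key t
  linarith [Real.add_one_le_exp (scoreSum ν₀ ν h - 2 * scoreSqSum ν₀ ν h)]

theorem Perturbation.integral_step_eq (hp : Perturbation ν₀ ν J δ η) (hδ : 0 < δ)
    (hs : ∀ q, |score ν₀ ν q| ≤ 1 / 2) (φ : Policy) {n : ℕ} (h : History n)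
    {f : ℝ≥0 × Bool → ℝ} (hf : Measurable f) {C : ℝ} (hC : ∀ q, |f q| ≤ C) :
    ∫ q, f q ∂step φ ν n h = ∫ q, f q * (1 + score ν₀ ν q) ∂step φ ν₀ n h := by
  have hC0 : 0 ≤ C := (abs_nonneg _).trans (hC (0, true))
  have hm : Measurable fun q => f q * (1 + score ν₀ ν q) :=
    hf.mul ((measurable_score ν₀ ν).const_add 1)
  rw [integral_step φ ν h hf hC, integral_step φ ν₀ h (C := C * 2) hm]
  · simp_rw [hp.integral_sale_eq hδ]
  · intro q
    rw [abs_mul]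
    refine mul_le_mul (hC q) ?_ (abs_nonneg _) hC0
    have := abs_le.1 (hs q)
    rw [abs_le]
    constructor <;> linarith

theorem Perturbation.integral_step_score (hp : Perturbation ν₀ ν J δ η) (hδ : 0 < δ)
    (hs : ∀ q, |score ν₀ ν q| ≤ 1 / 2) (φ : Policy) {n : ℕ} (h : History n) :
    ∫ q, score ν₀ ν q ∂step φ ν₀ n h = 0 := by
  rw [integral_step φ ν₀ h (measurable_score ν₀ ν) hs]
  simp_rw [hp.integral_sale_score hδ, integral_zero]

/-- Change of measure. -/
theorem Perturbation.integral_law_eq (hp : Perturbation ν₀ ν J δ η) (hδ : 0 < δ)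
    (hs : ∀ q, |score ν₀ ν q| ≤ 1 / 2) (φ : Policy) (n : ℕ) :
    ∀ f : History n → ℝ, Measurable f → ∀ C, (∀ h, |f h| ≤ C) →
    ∫ h, f h ∂law φ ν n = ∫ h, f h * likelihood ν₀ ν h ∂law φ ν₀ n := by
  induction n with
  | zero =>
    intro f _ C _
    simp [law, likelihood]
  | succ n ih =>
    intro f hf C hC
    have hC0 : 0 ≤ C := (abs_nonneg _).trans (hC fun _ => (0, true))
    have hfa : Measurable fun q : History n × (ℝ≥0 × Bool) => f (History.append q) :=
      hf.comp History.measurable_append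
    have hf1 (h : History n) : Measurable fun q => f (History.append (h, q)) :=
      hfa.comp measurable_prodMk_left
    have hm : Measurable fun h => f h * likelihood ν₀ ν h := hf.mul (measurable_likelihood _ _ _)
    rw [integral_law_succ φ ν hf hC, integral_law_succ φ ν₀ (C := C * 2 ^ (n + 1)) hm]
    · rw [ih _ _ C]
      · refine integral_congr_ae (.of_forall fun h => ?_)
        simp only
        rw [hp.integral_step_eq hδ hs φ h (hf1 h) fun q => hC _, ← integral_mul_const]
        refine integral_congr_ae (.of_forall fun q => ?_)
        simp only [likelihood, Fin.prod_univ_castSucc, History.append_castSucc,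
          History.append_last]
        ring
      · intro h
        refine (norm_integral_le_of_norm_le_const (μ := step φ ν n h)
          (f := fun q => f (History.append (h, q))) (C := C) (.of_forall fun q => hC _)).trans ?_
        simp
      · exact (hfa.stronglyMeasurable.integral_kernel_prod_right' (κ := step φ ν n)).measurable
    · intro h
      rw [abs_mul]
      exact mul_le_mul (hC h) (abs_likelihood_le hs h) (abs_nonneg _) hC0

theorem Perturbation.integral_scoreSum_sq (hp : Perturbation ν₀ ν J δ η) (hδ : 0 < δ)
    (hs : ∀ q, |score ν₀ ν q| ≤ 1 / 2) (φ : Policy) (n : ℕ) :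
    ∫ h, (scoreSum ν₀ ν h ^ 2 - scoreSqSum ν₀ ν h) ∂law φ ν₀ n = 0 := by
  induction n with
  | zero => simp [law, scoreSum, scoreSqSum]
  | succ n ih =>
    have hm : Measurable fun h : History (n + 1) => scoreSum ν₀ ν h ^ 2 - scoreSqSum ν₀ ν h :=
      ((measurable_scoreSum _ _ _).pow_const 2).sub (measurable_scoreSqSum _ _ _)
    rw [integral_law_succ φ ν₀ (C := ((n + 1 : ℕ) : ℝ) ^ 2 + (n + 1 : ℕ)) hm]
    · rw [← ih]
      refine integral_congr_ae (.of_forall fun h => ?_)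
      have e (q : ℝ≥0 × Bool) : scoreSum ν₀ ν (History.append (h, q)) ^ 2
          - scoreSqSum ν₀ ν (History.append (h, q)) = (scoreSum ν₀ ν h ^ 2 - scoreSqSum ν₀ ν h)
          + 2 * scoreSum ν₀ ν h * score ν₀ ν q := by
        simp only [scoreSum, scoreSqSum, Fin.sum_univ_castSucc, History.append_castSucc,
          History.append_last]
        ring
      simp only [e]
      rw [integral_add (integrable_const _)
        ((integrable_of_abs_le (measurable_score ν₀ ν) hs).const_mul _), integral_const_mul,
        hp.integral_step_score hδ hs]
      simp
    · intro h
      refine (abs_sub _ _).trans (add_le_add ?_ (abs_scoreSqSum_le hs h))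
      rw [abs_pow]
      gcongr
      exact abs_scoreSum_le hs h

theorem Perturbation.scoreSqSum_le (hp : Perturbation ν₀ ν J δ η) (hδ : 0 < δ) {n : ℕ}
    (h : History n) : scoreSqSum ν₀ ν h ≤ (η / δ) ^ 2 * visits J h := by
  rw [scoreSqSum, visits, Finset.mul_sum]
  refine Finset.sum_le_sum fun t _ => ?_
  have h1 := hp.abs_score_le hδ (h t)
  rw [← sq_abs]
  refine (pow_le_pow_left₀ (abs_nonneg _) h1 2).trans_eq ?_
  by_cases h : ((h t).1 : ℝ) ∈ J <;> simp [h]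

/-- A perturbation on a set that is rarely visited is hardly noticed. -/
theorem Perturbation.integral_visits_le (hp : Perturbation ν₀ ν J δ η) (hJ : MeasurableSet J)
    (hδ : 0 < δ) (hη : 0 ≤ η) (hηδ : η ≤ δ / 2) (φ : Policy) (n : ℕ) :
    ∫ h, visits J h ∂law φ ν n ≤ ∫ h, visits J h ∂law φ ν₀ n
      + n * (1 / 8 + 4 * (η / δ) ^ 2 * ∫ h, visits J h ∂law φ ν₀ n) := by
  have hs := hp.abs_score_le_half hδ hη hηδ
  set V := ∫ h, visits J h ∂law φ ν₀ n
  have hM : Integrable (fun h => scoreSum ν₀ ν h ^ 2) (law φ ν₀ n) :=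
    integrable_of_abs_le ((measurable_scoreSum _ _ _).pow_const 2) (C := (n : ℝ) ^ 2) fun h => by
      rw [abs_pow]
      gcongr
      exact abs_scoreSum_le hs h
  have hQ : Integrable (scoreSqSum ν₀ ν) (law φ ν₀ n) :=
    integrable_of_abs_le (measurable_scoreSqSum _ _ _) (abs_scoreSqSum_le hs)
  have hV := integrable_visits hJ (law φ ν₀ n)
  have hQV : ∫ h, scoreSqSum ν₀ ν h ∂law φ ν₀ n ≤ (η / δ) ^ 2 * V := by
    rw [← integral_const_mul]
    exact integral_mono hQ (hV.const_mul _) fun h => hp.scoreSqSum_le hδ h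
  have hMQ := hp.integral_scoreSum_sq hδ hs φ n
  rw [integral_sub hM hQ, sub_eq_zero] at hMQ
  have e1 : ∫ h, ((n : ℝ) - visits J h) ∂law φ ν n = n - ∫ h, visits J h ∂law φ ν n := by
    rw [integral_sub (integrable_const _) (integrable_visits hJ _)]
    simp
  have hb (h : History n) : |(n : ℝ) - visits J h| ≤ n := by
    have h1 := visits_nonneg J h
    have h2 := visits_le J h
    rw [abs_le]
    constructor <;> linarith
  have hmeas := (measurable_visits hJ n).const_sub (n : ℝ)
  rw [hp.integral_law_eq hδ hs φ n _ hmeas n hb] at e1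
  have i1 : Integrable (fun h : History n => (n : ℝ) * (7 / 8) - visits J h) (law φ ν₀ n) :=
    (integrable_const _).sub hV
  have i2 : Integrable (fun h : History n => (n : ℝ) * (2 * scoreSum ν₀ ν h ^ 2)) (law φ ν₀ n) :=
    (hM.const_mul 2).const_mul _
  have i3 : Integrable (fun h : History n => (n : ℝ) * (2 * scoreSqSum ν₀ ν h)) (law φ ν₀ n) :=
    (hQ.const_mul 2).const_mul _
  have i4 : Integrable (fun h : History n => (n : ℝ) * (7 / 8) - visits J h
      - n * (2 * scoreSum ν₀ ν h ^ 2)) (law φ ν₀ n) := i1.sub i2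
  have e2 : ∫ h, ((n : ℝ) * (7 / 8) - visits J h - n * (2 * scoreSum ν₀ ν h ^ 2)
      - n * (2 * scoreSqSum ν₀ ν h)) ∂law φ ν₀ n ≤
      ∫ h, ((n : ℝ) - visits J h) * likelihood ν₀ ν h ∂law φ ν₀ n := by
    refine integral_mono (i4.sub i3)
      (integrable_of_abs_le (hmeas.mul (measurable_likelihood _ _ _)) (C := n * 2 ^ n)
        fun h => ?_) fun h => ?_
    · rw [abs_mul]
      exact mul_le_mul (hb h) (abs_likelihood_le hs h) (abs_nonneg _) (by positivity)
    · have h1 := visits_nonneg J h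
      have h2 := visits_le J h
      have h3 := le_likelihood hs h
      have h4 : 0 ≤ scoreSqSum ν₀ ν h := Finset.sum_nonneg fun _ _ => sq_nonneg _
      have h5 : -(1 / 8 + 2 * scoreSum ν₀ ν h ^ 2 + 2 * scoreSqSum ν₀ ν h) ≤
          scoreSum ν₀ ν h - 2 * scoreSqSum ν₀ ν h := by
        nlinarith [sq_nonneg (4 * scoreSum ν₀ ν h + 1)]
      have h6 : 0 ≤ 1 / 8 + 2 * scoreSum ν₀ ν h ^ 2 + 2 * scoreSqSum ν₀ ν h := by positivity
      have h7 := mul_le_mul_of_nonneg_left h3 (sub_nonneg.2 h2)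
      have h8 := mul_le_mul_of_nonneg_left h5 (sub_nonneg.2 h2)
      have h9 := mul_nonneg h1 h6
      simp only
      linarith
  rw [integral_sub i4 i3, integral_sub i1 i2, integral_sub (integrable_const _) hV,
    integral_const_mul, integral_const_mul, integral_const_mul, integral_const_mul, hMQ] at e2
  have hVV : ∫ h, visits J h ∂law φ ν₀ n = V := rfl
  simp only [integral_const, integral_const_mul, hVV, probReal_univ, smul_eq_mul, one_mul] at e2
  have h0 : (0 : ℝ) ≤ n := n.cast_nonneg
  have := mul_le_mul_of_nonneg_left hQV h0
  linarith

end

theorem sum_indicator_le_one {N : ℕ} {J : Fin N → Set ℝ}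
    (hd : Pairwise (Function.onFun Disjoint J)) (x : ℝ) :
    ∑ j, (J j).indicator (1 : ℝ → ℝ) x ≤ 1 := by
  by_cases hx : ∃ j, x ∈ J j
  · obtain ⟨j, hj⟩ := hx
    rw [Finset.sum_eq_single j (fun i _ hij => Set.indicator_of_notMem
      (fun hi => Set.disjoint_left.1 (hd hij) hi hj) _) (by simp)]
    exact (indicator_one_mem _ _).2
  · push Not at hx
    simp [hx]

/-- Among `N` disjoint sets there is one that is visited in at most `n / N` rounds on average. -/
theorem exists_integral_visits_le (φ : Policy) (ν : Measure ℝ) (n N : ℕ) (hN : 0 < N)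
    (J : Fin N → Set ℝ) (hJ : ∀ j, MeasurableSet (J j)) (hd : Pairwise (Function.onFun Disjoint J)) :
    ∃ j, ∫ h, visits (J j) h ∂law φ ν n ≤ n / N := by
  by_contra! hlt
  have h1 : ∑ j, ∫ h, visits (J j) h ∂law φ ν n ≤ n := by
    rw [← integral_finsetSum _ fun j _ => integrable_visits (hJ j) _]
    have : ∫ h, ∑ j, visits (J j) h ∂law φ ν n ≤ ∫ _, (n : ℝ) ∂law φ ν n := by
      refine integral_mono (integrable_finsetSum _ fun j _ => integrable_visits (hJ j) _)
        (integrable_const _) fun h => ?_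
      simp only [visits]
      rw [Finset.sum_comm]
      refine (Finset.sum_le_sum fun t _ => sum_indicator_le_one hd ((h t).1 : ℝ)).trans ?_
      simp
    simpa using this
  have : Nonempty (Fin N) := ⟨⟨0, hN⟩⟩
  have h2 : ∑ _j : Fin N, (n : ℝ) / N < ∑ j, ∫ h, visits (J j) h ∂law φ ν n :=
    Finset.sum_lt_sum_of_nonempty Finset.univ_nonempty fun j _ => hlt j
  have h3 : (N : ℝ) ≠ 0 := by positivity
  simp only [Finset.sum_const, Finset.card_univ, Fintype.card_fin, nsmul_eq_mul] at h2
  rw [mul_div_cancel₀ _ h3] at h2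
  linarith

open scoped ContDiff

/-- `g` is a smooth nondecreasing majorant of the identity which is the identity on `[a, ∞)` and the
constant `r` on `(-∞, a / 2]`. -/
structure IsScale (a r : ℝ) (g : ℝ → ℝ) : Prop where
  contDiff : ContDiff ℝ ∞ g
  mono : Monotone g
  eq_self : ∀ x, a ≤ x → g x = x
  self_le : ∀ x, x ≤ g x
  eq_const : ∀ x ≤ a / 2, g x = r
  pos : 0 < r
  le : r ≤ a

theorem exists_isScale {a : ℝ} (ha : 0 < a) : ∃ r g, IsScale a r g := by
  set S : ℝ → ℝ := fun t => Real.smoothTransition (2 * t / a - 1)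
  have hSc : ContDiff ℝ ∞ S := by
    unfold S
    exact Real.smoothTransition.contDiff.comp (by fun_prop)
  have hSi (x y : ℝ) : IntervalIntegrable S volume x y := hSc.continuous.intervalIntegrable x y
  have hS0 (t : ℝ) : 0 ≤ S t := Real.smoothTransition.nonneg _
  have hS1 (t : ℝ) : S t ≤ 1 := Real.smoothTransition.le_one _
  set g : ℝ → ℝ := fun x => a + ∫ t in a..x, S t
  have hg (x y : ℝ) : g y - g x = ∫ t in x..y, S t := by
    simp only [g, add_sub_add_left_eq_sub]
    exact intervalIntegral.integral_interval_sub_left (hSi _ _) (hSi _ _)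
  have hga : g a = a := by simp [g]
  have hmono : Monotone g := fun x y hxy => by
    have := intervalIntegral.integral_nonneg (μ := volume) hxy fun t _ => hS0 t
    linarith [hg x y]
  have hgs (x : ℝ) (hx : a ≤ x) : g x = x := by
    have : ∫ t in a..x, S t = ∫ _ in a..x, (1 : ℝ) := by
      refine intervalIntegral.integral_congr fun t ht => ?_
      rw [Set.uIcc_of_le hx] at ht
      refine Real.smoothTransition.one_of_one_le ?_
      have : 2 ≤ 2 * t / a := by rw [le_div_iff₀ ha]; linarith [ht.1]
      linarith
    have h2 := hg a x
    rw [this] at h2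
    simp at h2
    linarith
  have hgc (x : ℝ) (hx : x ≤ a / 2) : g x = g (a / 2) := by
    have : ∫ t in x..a / 2, S t = ∫ _ in x..a / 2, (0 : ℝ) := by
      refine intervalIntegral.integral_congr fun t ht => ?_
      rw [Set.uIcc_of_le hx] at ht
      refine Real.smoothTransition.zero_of_nonpos ?_
      have : 2 * t / a ≤ 1 := by rw [div_le_iff₀ ha]; linarith [ht.2]
      linarith
    have h2 := hg x (a / 2)
    rw [this] at h2
    simp at h2
    linarith
  have hge (x : ℝ) : x ≤ g x := by
    rcases le_total a x with hx | hx
    · exact (hgs x hx).ge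
    · have h1 : ∫ t in x..a, S t ≤ ∫ _ in x..a, (1 : ℝ) :=
        intervalIntegral.integral_mono_on hx (hSi _ _) (by simp) fun t _ => hS1 t
      have h2 := hg x a
      simp at h1
      linarith
  refine ⟨g (a / 2), g, ?_, hmono, hgs, hge, hgc, by linarith [hge (a / 2)], ?_⟩
  · have hd (x : ℝ) : HasDerivAt g (S x) x :=
      (intervalIntegral.integral_hasDerivAt_right (hSi _ _)
        (hSc.continuous.stronglyMeasurableAtFilter _ _) hSc.continuous.continuousAt).const_add a
    rw [contDiff_infty_iff_deriv]
    refine ⟨fun x => (hd x).differentiableAt, ?_⟩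
    rwa [funext fun x => (hd x).deriv]
  · exact (hmono (by linarith)).trans_eq hga

theorem IsScale.const_le {a r : ℝ} {g : ℝ → ℝ} (hg : IsScale a r g) (x : ℝ) : r ≤ g x := by
  rcases le_total x (a / 2) with h | h
  · exact (hg.eq_const x h).ge
  · exact (hg.eq_const _ le_rfl).ge.trans (hg.mono h)

/-- `b` is a perturbation of size at most `M` that lives on `[a, c]`. -/
structure IsBump (a c L M : ℝ) (b : ℝ → ℝ) : Prop where
  eq_zero : ∀ x ∉ Set.Icc a c, b x = 0
  nonneg : ∀ x, 0 ≤ b x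
  le : ∀ x, b x ≤ M
  lipschitz : ∀ x y, |b x - b y| ≤ L * M * |x - y|

theorem IsBump.add {a c L M₁ M₂ : ℝ} {b₁ b₂ : ℝ → ℝ} (h₁ : IsBump a c L M₁ b₁)
    (h₂ : IsBump a c L M₂ b₂) : IsBump a c L (M₁ + M₂) fun x => b₁ x + b₂ x where
  eq_zero x hx := by simp [h₁.eq_zero x hx, h₂.eq_zero x hx]
  nonneg x := add_nonneg (h₁.nonneg x) (h₂.nonneg x)
  le x := add_le_add (h₁.le x) (h₂.le x)
  lipschitz x y := by
    have e : b₁ x + b₂ x - (b₁ y + b₂ y) = (b₁ x - b₁ y) + (b₂ x - b₂ y) := by ring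
    rw [e]
    refine (abs_add_le _ _).trans ?_
    linarith [h₁.lipschitz x y, h₂.lipschitz x y]

theorem IsBump.mono {a c L M₁ M₂ : ℝ} {b : ℝ → ℝ} (h : IsBump a c L M₁ b) (hL : 0 ≤ L)
    (hM : M₁ ≤ M₂) : IsBump a c L M₂ b where
  eq_zero := h.eq_zero
  nonneg := h.nonneg
  le x := (h.le x).trans hM
  lipschitz x y := (h.lipschitz x y).trans (by gcongr)

theorem IsBump.continuous {a c L M : ℝ} {b : ℝ → ℝ} (h : IsBump a c L M b) : Continuous b := by
  refine LipschitzWith.continuous (K := (L * M).toNNReal) (.of_dist_le' fun x y => ?_)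
  rw [Real.dist_eq, Real.dist_eq]
  exact h.lipschitz x y

theorem IsBump.of_tendsto {a c L M : ℝ} {b : ℕ → ℝ → ℝ} {b' : ℝ → ℝ}
    (h : ∀ n, IsBump a c L M (b n)) (hb : ∀ x, Tendsto (fun n => b n x) atTop (𝓝 (b' x))) :
    IsBump a c L M b' where
  eq_zero x hx := tendsto_nhds_unique (hb x) (by simp [(h _).eq_zero x hx])
  nonneg x := ge_of_tendsto' (hb x) fun n => (h n).nonneg x
  le x := le_of_tendsto' (hb x) fun n => (h n).le x
  lipschitz x y := le_of_tendsto' ((hb x).sub (hb y)).abs fun n => (h n).lipschitz x y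

/-- The market with demand `r * (1 + b x) / g x` at the price `x`. -/
def HasDemand (r : ℝ) (g b : ℝ → ℝ) (ν : Measure ℝ) : Prop :=
  ∀ x, cdf ν x = 1 - r * (1 + b x) / g x

theorem exists_hasDemand {a a' c r L M : ℝ} {g b : ℝ → ℝ} (ha : 0 < a) (ha' : a < a')
    (hg : IsScale a r g) (hb : IsBump a' c L M b) (hLM : L * M * c ≤ 1) (hL : 0 ≤ L) (hM : 0 ≤ M) :
    ∃ ν : Measure ℝ, IsProbabilityMeasure ν ∧ HasDemand r g b ν := by
  have hr := hg.pos
  have hgp (x : ℝ) : 0 < g x := hr.trans_le (hg.const_le x)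
  have hanti : ∀ x y, x ≤ y → (1 + b y) * g x ≤ (1 + b x) * g y := by
    have key : ∀ x y, a ≤ x → x ≤ y → (1 + b y) * g x ≤ (1 + b x) * g y := by
      intro x y hx hxy
      by_cases hy : y ∈ Set.Icc a' c
      · rw [hg.eq_self x hx, hg.eq_self y (hx.trans hxy)]
        have h1 := (le_abs_self _).trans (hb.lipschitz y x)
        rw [abs_of_nonneg (sub_nonneg.2 hxy)] at h1
        have h2 : L * M * x ≤ 1 := by
          refine le_trans ?_ hLM
          have := hxy.trans hy.2
          gcongr
        nlinarith [mul_le_mul_of_nonneg_left h1 (ha.le.trans hx),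
          mul_le_mul_of_nonneg_right h2 (sub_nonneg.2 hxy),
          mul_nonneg (hb.nonneg x) (sub_nonneg.2 hxy)]
      · rw [hb.eq_zero y hy]
        nlinarith [hg.mono hxy, mul_nonneg (hb.nonneg x) (hgp y).le]
    intro x y hxy
    rcases le_total a x with hx | hx
    · exact key x y hx hxy
    · rw [hb.eq_zero x fun h => by linarith [h.1]]
      rcases le_total a y with hy | hy
      · have h1 := key a y le_rfl hy
        rw [hb.eq_zero a fun h => by linarith [h.1]] at h1
        refine le_trans ?_ h1
        exact mul_le_mul_of_nonneg_left (hg.mono hx) (by linarith [hb.nonneg y])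
      · rw [hb.eq_zero y fun h => by linarith [h.1]]
        linarith [hg.mono hxy]
  have hcont : Continuous fun x => 1 - r * (1 + b x) / g x := by
    have := hb.continuous
    have := hg.contDiff.continuous
    exact continuous_const.sub (Continuous.div (by fun_prop) this fun x => (hgp x).ne')
  let F : StieltjesFunction ℝ :=
    { toFun := fun x => 1 - r * (1 + b x) / g x
      mono' := fun x y hxy => by
        have := hanti x y hxy
        refine sub_le_sub_left ?_ 1
        rw [div_le_div_iff₀ (hgp y) (hgp x), mul_assoc, mul_assoc]
        exact mul_le_mul_of_nonneg_left this hr.le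
      right_continuous' := fun x => hcont.continuousWithinAt }
  have h0 : Tendsto F atBot (𝓝 0) := by
    refine tendsto_const_nhds.congr' ?_
    filter_upwards [Iic_mem_atBot (a / 2)] with x hx
    rw [Set.mem_Iic] at hx
    change 0 = 1 - r * (1 + b x) / g x
    rw [hb.eq_zero x fun h => by linarith [h.1], hg.eq_const x hx]
    field_simp
    simp
  have h1 : Tendsto F atTop (𝓝 1) := by
    have : Tendsto (fun x : ℝ => 1 - r / x) atTop (𝓝 (1 - 0)) :=
      tendsto_const_nhds.sub (tendsto_const_nhds.div_atTop tendsto_id)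
    rw [sub_zero] at this
    refine this.congr' ?_
    filter_upwards [Ici_mem_atTop a, Ioi_mem_atTop c] with x hx hxc
    rw [Set.mem_Ici] at hx
    rw [Set.mem_Ioi] at hxc
    change _ = 1 - r * (1 + b x) / g x
    rw [hb.eq_zero x fun h => by linarith [h.2], hg.eq_self x hx]
    simp
  refine ⟨F.measure, ⟨?_⟩, fun x => ?_⟩
  · rw [F.measure_univ h0 h1, sub_zero, ENNReal.ofReal_one]
  · rw [cdf_measure_stieltjesFunction F h0 h1]

theorem HasDemand.revenue_eq {r : ℝ} {g b : ℝ → ℝ} {ν : Measure ℝ} (hν : HasDemand r g b ν)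
    (x : ℝ) : revenue ν x = r * (1 + b x) * (x / g x) := by
  rw [revenue, hν x]
  ring

theorem HasDemand.revenue_le {a r : ℝ} {g b : ℝ → ℝ} {ν : Measure ℝ} (hν : HasDemand r g b ν)
    (hg : IsScale a r g) (hb : ∀ x, 0 ≤ b x) (x : ℝ) : revenue ν x ≤ r * (1 + b x) := by
  have hr := hg.pos
  have := hb x
  rw [hν.revenue_eq x]
  refine mul_le_of_le_one_right (by positivity) ?_
  rw [div_le_one (hr.trans_le (hg.const_le x))]
  exact hg.self_le x

theorem HasDemand.timesDifferentiableOn {a r c₁ c₂ : ℝ} {g b : ℝ → ℝ} {ν : Measure ℝ}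
    (hν : HasDemand r g b ν) (hg : IsScale a r g) {m : ℕ} (hb : ContDiff ℝ m b) (hc : c₁ < c₂) :
    TimesDifferentiableOn m (cdf ν) (Set.Icc c₁ c₂) := by
  intro k hk
  have hF : ContDiff ℝ m (cdf ν) := by
    have e : (cdf ν : ℝ → ℝ) = fun x => 1 - r * (1 + b x) / g x := funext hν
    rw [e]
    have hg' : ContDiff ℝ m g := hg.contDiff.of_le (by exact_mod_cast le_top)
    exact contDiff_const.sub (ContDiff.div (by fun_prop) hg'
      fun x => (hg.pos.trans_le (hg.const_le x)).ne')
  exact hF.contDiffOn.differentiableOn_iteratedDerivWithin (by exact_mod_cast hk)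
    (uniqueDiffOn_Icc hc)

/-- A smooth profile which is `1` on `[-1, 1]` and vanishes off `[-2, 2]`. -/
structure IsProfile (L : ℝ) (ψ : ℝ → ℝ) : Prop where
  contDiff : ContDiff ℝ ∞ ψ
  nonneg : ∀ x, 0 ≤ ψ x
  le_one : ∀ x, ψ x ≤ 1
  eq_one : ∀ x, |x| ≤ 1 → ψ x = 1
  eq_zero : ∀ x, 2 ≤ |x| → ψ x = 0
  lipschitz : ∀ x y, |ψ x - ψ y| ≤ L * |x - y|
  bounded : ∀ k : ℕ, ∃ A, ∀ x, ‖iteratedDeriv k ψ x‖ ≤ A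

theorem exists_isProfile : ∃ L ψ, 0 ≤ L ∧ IsProfile L ψ := by
  let ψ : ContDiffBump (0 : ℝ) := ⟨1, 2, one_pos, one_lt_two⟩
  obtain ⟨L, hL⟩ := (ψ.contDiff (n := 1)).lipschitzWith_of_hasCompactSupport ψ.hasCompactSupport
    one_ne_zero
  refine ⟨L, ψ, L.2, ψ.contDiff, fun x => ψ.nonneg, fun x => ψ.le_one, fun x hx => ?_,
    fun x hx => ?_, fun x y => ?_, fun k => ?_⟩
  · exact ψ.one_of_mem_closedBall (by simpa [ψ] using hx)
  · exact ψ.zero_of_le_dist (by simpa [ψ] using hx)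
  · simpa [Real.dist_eq] using hL.dist_le_mul x y
  · obtain ⟨A, hA⟩ := (ψ.hasCompactSupport.iteratedFDeriv (𝕜 := ℝ) k).exists_bound_of_continuous
      (ContDiff.continuous_iteratedFDeriv (n := k) (by simp) ψ.contDiff)
    exact ⟨A, fun x => by rw [← norm_iteratedFDeriv_eq_norm_iteratedDeriv]; exact hA x⟩

/-- The profile `ψ`, moved to `c` and scaled to the width `w` and height `h`. -/
noncomputable def bump (ψ : ℝ → ℝ) (c w h x : ℝ) : ℝ := h * ψ (w⁻¹ * (x - c))

section

variable {ψ : ℝ → ℝ} {L c w h x : ℝ} (hψ : IsProfile L ψ)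
include hψ

theorem IsProfile.bump_nonneg (hh : 0 ≤ h) : 0 ≤ bump ψ c w h x :=
  mul_nonneg hh (hψ.nonneg _)

theorem IsProfile.bump_le (hh : 0 ≤ h) : bump ψ c w h x ≤ h :=
  mul_le_of_le_one_right hh (hψ.le_one _)

theorem IsProfile.bump_eq (hw : 0 < w) (hx : x ∈ Set.Icc (c - w) (c + w)) :
    bump ψ c w h x = h := by
  rw [bump, hψ.eq_one, mul_one]
  rw [abs_mul, abs_inv, abs_of_pos hw, inv_mul_le_one₀ hw, abs_le]
  constructor <;> linarith [hx.1, hx.2]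

theorem IsProfile.bump_eq_zero (hw : 0 < w) (hx : x ∉ Set.Icc (c - 2 * w) (c + 2 * w)) :
    bump ψ c w h x = 0 := by
  rw [bump, hψ.eq_zero, mul_zero]
  rw [abs_mul, abs_inv, abs_of_pos hw, le_inv_mul_iff₀ hw]
  by_contra! hlt
  rw [abs_lt] at hlt
  exact hx ⟨by linarith, by linarith⟩

theorem IsProfile.isBump {a c₂ M : ℝ} (hL : 0 ≤ L) (hw : 0 < w) (hw1 : w ≤ 1) (hh : 0 ≤ h)
    (hM : h ≤ M * w) (hJ : Set.Icc (c - 2 * w) (c + 2 * w) ⊆ Set.Icc a c₂) :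
    IsBump a c₂ L M (bump ψ c w h) where
  eq_zero x hx := hψ.bump_eq_zero hw fun hx' => hx (hJ hx')
  nonneg x := hψ.bump_nonneg hh
  le x := by
    have hM0 : 0 ≤ M := nonneg_of_mul_nonneg_left (hh.trans hM) hw
    exact (hψ.bump_le hh).trans (hM.trans (mul_le_of_le_one_right hM0 hw1))
  lipschitz x y := by
    have h1 := hψ.lipschitz (w⁻¹ * (x - c)) (w⁻¹ * (y - c))
    rw [← mul_sub, sub_sub_sub_cancel_right, abs_mul, abs_of_pos (inv_pos.2 hw)] at h1
    rw [bump, bump, ← mul_sub, abs_mul, abs_of_nonneg hh]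
    calc h * |ψ (w⁻¹ * (x - c)) - ψ (w⁻¹ * (y - c))| ≤ h * (L * (w⁻¹ * |x - y|)) := by gcongr
      _ ≤ (M * w) * (L * (w⁻¹ * |x - y|)) := by gcongr
      _ = L * M * |x - y| := by field_simp

theorem IsProfile.contDiff_bump (n : ℕ) : ContDiff ℝ n (bump ψ c w h) := by
  have := hψ.contDiff.of_le (m := n) (by exact_mod_cast le_top)
  unfold bump
  fun_prop

theorem IsProfile.norm_iteratedFDeriv_bump_le (hw : 0 < w) (hh : 0 ≤ h) {k : ℕ} {A : ℝ}
    (hA : ∀ x, ‖iteratedDeriv k ψ x‖ ≤ A) :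
    ‖iteratedFDeriv ℝ k (bump ψ c w h) x‖ ≤ h * (w⁻¹ ^ k * A) := by
  have hc := hψ.contDiff.of_le (m := k) (by exact_mod_cast le_top)
  have e : bump ψ c w h = fun x => h * (fun y => ψ (w⁻¹ * y)) (x - c) := rfl
  rw [norm_iteratedFDeriv_eq_norm_iteratedDeriv, e, iteratedDeriv_const_mul_field,
    congrFun (iteratedDeriv_comp_sub_const k (fun y => ψ (w⁻¹ * y)) c) x,
    congrFun (iteratedDeriv_comp_const_mul hc w⁻¹) (x - c), norm_mul, norm_mul, norm_pow,
    Real.norm_of_nonneg hh, Real.norm_of_nonneg (inv_pos.2 hw).le]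
  gcongr
  exact hA _

end

/-- An interval of length `2 * w` contains at least `w / (8 * w')` disjoint intervals of length
`4 * w'`. -/
theorem exists_disjoint_intervals (c : ℝ) {w w' : ℝ} (hw' : 0 < w') (hle : w' ≤ w / 8) :
    ∃ (N : ℕ) (d : Fin N → ℝ), w / (8 * w') ≤ N ∧ 0 < N ∧
      (∀ j, Set.Icc (d j - 2 * w') (d j + 2 * w') ⊆ Set.Icc (c - w) (c + w)) ∧
      Pairwise (Function.onFun Disjoint fun j => Set.Icc (d j - 2 * w') (d j + 2 * w')) := by
  have hw : 0 < w := by linarith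
  have h1 : 1 ≤ w / (8 * w') := by rw [le_div_iff₀ (by positivity)]; linarith
  have hlt := Nat.ceil_lt_add_one (a := w / (8 * w')) (by positivity)
  have hle := Nat.le_ceil (w / (8 * w'))
  set N := ⌈w / (8 * w')⌉₊
  have hN : (N : ℝ) * w' ≤ w / 4 := by
    calc (N : ℝ) * w' ≤ (2 * (w / (8 * w'))) * w' := by gcongr; linarith
      _ = w / 4 := by field_simp; norm_num
  have hjN (j : Fin N) : ((j : ℕ) + 1 : ℝ) * w' ≤ w / 4 := by
    refine le_trans ?_ hN
    gcongr
    exact_mod_cast j.2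
  refine ⟨N, fun j => c - w + 5 * ((j : ℕ) + 1) * w', hle, ?_, fun j => ?_, ?_⟩
  · exact_mod_cast (by linarith : (0 : ℝ) < N)
  · have h2 : 0 ≤ ((j : ℕ) : ℝ) * w' := by positivity
    have h3 := hjN j
    refine Set.Icc_subset_Icc ?_ ?_ <;> nlinarith
  · have key : ∀ i j : Fin N, (i : ℕ) < j → Disjoint
        (Set.Icc (c - w + 5 * ((i : ℕ) + 1) * w' - 2 * w') (c - w + 5 * ((i : ℕ) + 1) * w' + 2 * w'))
        (Set.Icc (c - w + 5 * ((j : ℕ) + 1) * w' - 2 * w')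
          (c - w + 5 * ((j : ℕ) + 1) * w' + 2 * w')) := by
      intro i j hij
      rw [Set.disjoint_left]
      intro x hi hj
      have h4 : ((i : ℕ) + 1 : ℝ) ≤ (j : ℕ) := by exact_mod_cast hij
      have h5 := mul_le_mul_of_nonneg_right h4 hw'.le
      nlinarith [hi.2, hj.1]
    intro i j hij
    rcases lt_or_gt_of_ne (Fin.val_ne_of_ne hij) with h | h
    · exact key i j h
    · exact (key j i h).symm

/-- The width of the bump for the horizon `T`. -/
noncomputable def width (m T : ℕ) : ℝ := (T : ℝ) ^ (-(1 / (2 * (m : ℝ) + 1)))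

/-- The factor that separates the two rates at the horizon `T`. -/
noncomputable def slack (ζ : ℝ) (T : ℕ) : ℝ := (T : ℝ) ^ (-(ζ / 2))

/-- The height of the bump for the horizon `T`. -/
noncomputable def height (m : ℕ) (ζ : ℝ) (T : ℕ) : ℝ := width m T ^ m * slack ζ T

theorem tendsto_width (m : ℕ) : Tendsto (width m) atTop (𝓝 0) :=
  (tendsto_rpow_neg_atTop (by positivity)).comp tendsto_natCast_atTop_atTop

theorem tendsto_slack {ζ : ℝ} (hζ : 0 < ζ) : Tendsto (slack ζ) atTop (𝓝 0) :=
  (tendsto_rpow_neg_atTop (by positivity)).comp tendsto_natCast_atTop_atTop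

section

variable {m T : ℕ} {ζ : ℝ} (hT : 1 ≤ T)
include hT

theorem width_pos : 0 < width m T := Real.rpow_pos_of_pos (by exact_mod_cast hT) _

theorem slack_pos : 0 < slack ζ T := Real.rpow_pos_of_pos (by exact_mod_cast hT) _

theorem height_pos : 0 < height m ζ T := mul_pos (pow_pos (width_pos hT) _) (slack_pos hT)

theorem width_le_one : width m T ≤ 1 :=
  Real.rpow_le_one_of_one_le_of_nonpos (by exact_mod_cast hT)
    (neg_nonpos.2 (by positivity))

theorem height_le_slack : height m ζ T ≤ slack ζ T :=
  mul_le_of_le_one_left (slack_pos hT).le (pow_le_one₀ (width_pos hT).le (width_le_one hT))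

theorem height_le (hm : 1 ≤ m) : height m ζ T ≤ slack ζ T * width m T := by
  rw [height, mul_comm]
  refine mul_le_mul_of_nonneg_left ?_ (slack_pos hT).le
  exact pow_le_of_le_one (width_pos hT).le (width_le_one hT) (by omega)

theorem width_pow : (T : ℝ) * (width m T) ^ (2 * m + 1) = 1 := by
  have hT0 : (0 : ℝ) < T := by exact_mod_cast hT
  rw [width, ← Real.rpow_mul_natCast hT0.le]
  have : -(1 / (2 * (m : ℝ) + 1)) * ((2 * m + 1 : ℕ) : ℝ) = -1 := by
    push_cast
    field_simp
  rw [this, Real.rpow_neg_one, mul_inv_cancel₀ hT0.ne']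

theorem height_sq : (T : ℝ) * width m T * height m ζ T ^ 2 = slack ζ T ^ 2 := by
  have := width_pow (m := m) hT
  calc (T : ℝ) * width m T * height m ζ T ^ 2
      = (T * (width m T) ^ (2 * m + 1)) * slack ζ T ^ 2 := by rw [height]; ring
    _ = _ := by rw [this, one_mul]

theorem mul_height : (T : ℝ) * height m ζ T =
    (T : ℝ) ^ (((m : ℝ) + 1) / (2 * (m : ℝ) + 1) - ζ) * (T : ℝ) ^ (ζ / 2) := by
  have hT0 : (0 : ℝ) < T := by exact_mod_cast hT
  rw [height, width, slack, ← Real.rpow_mul_natCast hT0.le, ← Real.rpow_add hT0]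
  nth_rw 1 [← Real.rpow_one (T : ℝ)]
  rw [← Real.rpow_add hT0, ← Real.rpow_add hT0]
  congr 1
  field_simp
  ring

end

/-- A bump in the least visited of many disjoint intervals is hardly noticed. -/
theorem exists_bump_location {a a' c₂ r L M δ : ℝ} {g b : ℝ → ℝ} (ha : 0 < a) (ha' : a < a')
    (hg : IsScale a r g) (hb : IsBump a' c₂ L M b) (hLM : L * M * c₂ ≤ 1) (hL : 0 ≤ L)
    (hM : 0 ≤ M) (hδ : 0 < δ) (hδr : δ * c₂ ≤ r) (hδa : a * (1 + M) ≤ (1 - δ) * a')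
    (φ : ℕ → Policy) (m : ℕ) {ζ : ℝ} (hζ : 0 < ζ) {c w : ℝ} (hw : 0 < w)
    (hI : Set.Icc (c - w) (c + w) ⊆ Set.Icc a' c₂) :
    ∀ᶠ T : ℕ in atTop, ∃ d,
      Set.Icc (d - 2 * width m T) (d + 2 * width m T) ⊆ Set.Icc (c - w) (c + w) ∧
      ∀ (ν : Measure ℝ) (b' : ℝ → ℝ), HasDemand r g b' ν →
        (∀ x ∉ Set.Icc (d - 2 * width m T) (d + 2 * width m T), b' x = b x) →
        (∀ x, b x ≤ b' x ∧ b' x ≤ b x + 2 * height m ζ T) →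
        ∫ h, visits (Set.Icc (d - 2 * width m T) (d + 2 * width m T)) h ∂law (φ T) ν T
          ≤ 3 / 4 * T := by
  obtain ⟨ν₀, -, hν₀⟩ := exists_hasDemand ha ha' hg hb hLM hL hM
  have hr := hg.pos
  filter_upwards [eventually_ge_atTop 1,
    (tendsto_width m).eventually_le_const (by positivity : 0 < w / 32),
    (tendsto_slack hζ).eventually_le_const (by positivity : 0 < δ / 4),
    (tendsto_slack hζ).eventually_le_const one_pos,
    (tendsto_slack hζ).eventually_le_const (by positivity : 0 < δ ^ 2 * w / 512)]
    with T hT hTw hT1 hT2 hT3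
  have hw' := width_pos (m := m) hT
  have hh' := height_pos (m := m) (ζ := ζ) hT
  have hs := slack_pos (ζ := ζ) hT
  have hhs := height_le_slack (m := m) (ζ := ζ) hT
  have hhsq := height_sq (m := m) (ζ := ζ) hT
  have hT0 : (0 : ℝ) < T := by exact_mod_cast hT
  set w' := width m T
  set h' := height m ζ T
  set u := slack ζ T
  obtain ⟨N, d, hN, hN0, hsub, hd⟩ := exists_disjoint_intervals c (w := w) hw' (by linarith)
  obtain ⟨j, hj⟩ := exists_integral_visits_le (φ T) ν₀ T N hN0 _ (fun j => measurableSet_Icc) hd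
  refine ⟨d j, hsub j, fun ν b' hν hoff hon => ?_⟩
  set J := Set.Icc (d j - 2 * w') (d j + 2 * w')
  set V := ∫ h, visits J h ∂law (φ T) ν₀ T
  have hp : Perturbation ν₀ ν J δ (2 * h') := by
    refine ⟨fun p hpJ => ?_, fun p hpJ => ?_, fun p hpJ => ?_, fun p hpJ => ?_⟩
    · rw [hν p, hν₀ p, hoff p hpJ]
    all_goals
      have hpI := hI (hsub j hpJ)
      have hpa : a ≤ p := ha'.le.trans hpI.1
      have hp0 : 0 < p := ha.trans_le hpa
    · rw [hν p, hν₀ p, hg.eq_self p hpa]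
      have e : 1 - r * (1 + b' p) / p - (1 - r * (1 + b p) / p) = -(r / p * (b' p - b p)) := by
        ring
      have h1 : 0 ≤ b' p - b p := by linarith [(hon p).1]
      have h2 : r / p ≤ 1 := by rw [div_le_one hp0]; exact hg.le.trans hpa
      rw [e, abs_neg, abs_of_nonneg (by positivity)]
      have := mul_le_of_le_one_left h1 h2
      linarith [(hon p).2]
    · rw [hν₀ p, hg.eq_self p hpa, le_sub_comm, div_le_iff₀ hp0]
      have h3 : δ ≤ 1 := by
        by_contra! h
        nlinarith [mul_pos ha (by linarith : 0 < 1 + M)]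
      calc r * (1 + b p) ≤ a * (1 + M) := by
            have := hb.nonneg p
            have := hb.le p
            have := hg.le
            gcongr
        _ ≤ (1 - δ) * a' := hδa
        _ ≤ (1 - δ) * p := mul_le_mul_of_nonneg_left hpI.1 (by linarith)
    · rw [hν₀ p, hg.eq_self p hpa, sub_sub_cancel, le_div_iff₀ hp0]
      calc δ * p ≤ δ * c₂ := by gcongr; exact hpI.2
        _ ≤ r := hδr
        _ ≤ r * (1 + b p) := le_mul_of_one_le_right hr.le (by linarith [hb.nonneg p])
  have hV : V ≤ 8 * T * w' / w := by
    refine hj.trans ?_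
    have : 0 < w / (8 * w') := by positivity
    calc (T : ℝ) / N ≤ T / (w / (8 * w')) := by gcongr
      _ = 8 * T * w' / w := by field_simp
  have hV1 : V ≤ T / 4 := by
    refine hV.trans ?_
    rw [div_le_iff₀ hw]
    nlinarith
  have hV2 : 4 * (2 * h' / δ) ^ 2 * V ≤ 1 / 4 := by
    calc 4 * (2 * h' / δ) ^ 2 * V ≤ 4 * (2 * h' / δ) ^ 2 * (8 * T * w' / w) := by gcongr
      _ = 128 * (T * w' * h' ^ 2) / (δ ^ 2 * w) := by field_simp; ring
      _ = 128 * u ^ 2 / (δ ^ 2 * w) := by rw [hhsq]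
      _ ≤ 1 / 4 := by
        rw [div_le_iff₀ (by positivity)]
        nlinarith
  have key := hp.integral_visits_le measurableSet_Icc hδ (by positivity) (by linarith) (φ T) T
  change _ ≤ V + T * (1 / 8 + 4 * (2 * h' / δ) ^ 2 * V) at key
  have := mul_le_mul_of_nonneg_left hV2 hT0.le
  linarith

/-- Under the policy `φ`, bumps of height at most `2 * height m ζ T` on the interval of half-width
`2 * width m T` around `d` attract at most three quarters of the rounds. -/
def Unnoticed (φ : Policy) (m : ℕ) (ζ r : ℝ) (g b : ℝ → ℝ) (d : ℝ) (T : ℕ) : Prop :=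
  ∀ (ν : Measure ℝ) (b' : ℝ → ℝ), HasDemand r g b' ν →
    (∀ x ∉ Set.Icc (d - 2 * width m T) (d + 2 * width m T), b' x = b x) →
    (∀ x, b x ≤ b' x ∧ b' x ≤ b x + 2 * height m ζ T) →
    ∫ h, visits (Set.Icc (d - 2 * width m T) (d + 2 * width m T)) h ∂law φ ν T ≤ 3 / 4 * T

/-- A finite sum `b` of bumps, the last of which has centre `c`, width `w` and height `h`. -/
structure Stage where
  b : ℝ → ℝ
  c : ℝ
  w : ℝ
  h : ℝ

/-- The next stage, with a bump around `d` that is adapted to the horizon `T`. -/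
noncomputable def Stage.next (s : Stage) (ψ : ℝ → ℝ) (m : ℕ) (ζ d : ℝ) (T : ℕ) : Stage where
  b x := s.b x + bump ψ d (width m T) (height m ζ T) x
  c := d
  w := width m T
  h := height m ζ T

/-- The bumps of stage `n` have used up the share `1 - (1 / 2) ^ n` of `M`, and the last one is
flat inside `[a, c₂]`. -/
structure Stage.Valid (a c₂ L M : ℝ) (n : ℕ) (s : Stage) : Prop where
  isBump : IsBump a c₂ L (M * (1 - (1 / 2) ^ n)) s.b
  w_pos : 0 < s.w
  h_pos : 0 < s.h
  subset : Set.Icc (s.c - s.w) (s.c + s.w) ⊆ Set.Icc a c₂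

/-- A sequence of nested bumps, with centres `c n` and adapted to the horizons `T n`, each of which
is hardly noticed by the policy for its horizon. -/
structure IsNested (a c₂ L M r : ℝ) (g ψ : ℝ → ℝ) (φ : ℕ → Policy) (m : ℕ) (ζ : ℝ)
    (T : ℕ → ℕ) (c : ℕ → ℝ) : Prop where
  le_horizon : ∀ n, n ≤ T n
  one_le_horizon : ∀ n, 1 ≤ T n
  slack_le : ∀ n, slack ζ (T n) ≤ M * (1 / 2) ^ (n + 1)
  height_succ_le : ∀ n, height m ζ (T (n + 1)) ≤ height m ζ (T n) / 2
  subset : ∀ n, Set.Icc (c n - 2 * width m (T n)) (c n + 2 * width m (T n)) ⊆ Set.Icc a c₂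
  subset_succ : ∀ n,
    Set.Icc (c (n + 1) - 2 * width m (T (n + 1))) (c (n + 1) + 2 * width m (T (n + 1))) ⊆
      Set.Icc (c n - width m (T n)) (c n + width m (T n))
  isBump : ∀ n, IsBump a c₂ L M fun x =>
    ∑ k ∈ Finset.range n, bump ψ (c k) (width m (T k)) (height m ζ (T k)) x
  unnoticed : ∀ n, Unnoticed (φ (T n)) m ζ r g
    (fun x => ∑ k ∈ Finset.range n, bump ψ (c k) (width m (T k)) (height m ζ (T k)) x) (c n) (T n)

theorem exists_isNested {a a' c₂ r L M δ : ℝ} {g ψ : ℝ → ℝ} (ha : 0 < a) (ha' : a < a')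
    (hc₂ : a' < c₂) (hg : IsScale a r g) (hψ : IsProfile L ψ) (hLM : L * M * c₂ ≤ 1) (hL : 0 ≤ L)
    (hM : 0 < M) (hδ : 0 < δ) (hδr : δ * c₂ ≤ r) (hδa : a * (1 + M) ≤ (1 - δ) * a')
    (φ : ℕ → Policy) {m : ℕ} (hm : 1 ≤ m) {ζ : ℝ} (hζ : 0 < ζ) :
    ∃ T c, IsNested a' c₂ L M r g ψ φ m ζ T c := by
  have step (n : ℕ) (s : {s : Stage // s.Valid a' c₂ L M n}) :
      ∃ s' : {s : Stage // s.Valid a' c₂ L M (n + 1)}, ∃ (T : ℕ) (d : ℝ),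
        s'.1 = s.1.next ψ m ζ d T ∧ n ≤ T ∧ 1 ≤ T ∧ slack ζ T ≤ M * (1 / 2) ^ (n + 1) ∧
        height m ζ T ≤ s.1.h / 2 ∧
        Set.Icc (d - 2 * width m T) (d + 2 * width m T) ⊆
          Set.Icc (s.1.c - s.1.w) (s.1.c + s.1.w) ∧
        Unnoticed (φ T) m ζ r g s.1.b d T := by
    obtain ⟨s, hs⟩ := s
    have hb : IsBump a' c₂ L M s.b := hs.isBump.mono hL
      (mul_le_of_le_one_right hM.le (sub_le_self _ (by positivity)))
    have hh := hs.h_pos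
    obtain ⟨T, ⟨d, hsub, hun⟩, hnT, h1T, hsl, hsh⟩ := ((exists_bump_location ha ha' hg hb hLM hL
      hM.le hδ hδr hδa φ m hζ hs.w_pos hs.subset).and <| (eventually_ge_atTop n).and <|
      (eventually_ge_atTop 1).and <|
      ((tendsto_slack hζ).eventually_le_const (by positivity : 0 < M * (1 / 2) ^ (n + 1))).and <|
      (tendsto_slack hζ).eventually_le_const (by positivity : 0 < s.h / 2)).exists
    have hw := width_pos (m := m) h1T
    have hht := height_pos (m := m) (ζ := ζ) h1T
    refine ⟨⟨s.next ψ m ζ d T, ?_, hw, hht, ?_⟩, T, d, rfl, hnT, h1T, hsl,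
      (height_le_slack h1T).trans hsh, hsub, hun⟩
    · have h1 : IsBump a' c₂ L (M * (1 / 2) ^ (n + 1)) (bump ψ d (width m T) (height m ζ T)) :=
        hψ.isBump hL hw (width_le_one h1T) hht.le
          ((height_le h1T hm).trans (mul_le_mul_of_nonneg_right hsl hw.le)) (hsub.trans hs.subset)
      have h2 := hs.isBump.add h1
      have e : M * (1 - (1 / 2) ^ n) + M * (1 / 2) ^ (n + 1) = M * (1 - (1 / 2) ^ (n + 1)) := by
        ring
      rwa [e] at h2
    · refine (Set.Icc_subset_Icc ?_ ?_).trans (hsub.trans hs.subset) <;>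
        simp only [Stage.next] <;> linarith
  choose next T d hnext hnT h1T hsl hht hsub hun using step
  let s₀ : {s : Stage // s.Valid a' c₂ L M 0} :=
    ⟨⟨fun _ => 0, (a' + c₂) / 2, (c₂ - a') / 2, 1⟩, ⟨by simp, by simp, by simp, by simp⟩,
      by simpa using hc₂, one_pos, Set.Icc_subset_Icc (by simp only; linarith)
        (by simp only; linarith)⟩
  let S : ∀ n, {s : Stage // s.Valid a' c₂ L M n} := fun n => Nat.rec s₀ next n
  have hS (n : ℕ) : (S (n + 1)).1 = (S n).1.next ψ m ζ (d n (S n)) (T n (S n)) := hnext n (S n)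
  have hb (n : ℕ) : (S n).1.b = fun x => ∑ k ∈ Finset.range n,
      bump ψ (d k (S k)) (width m (T k (S k))) (height m ζ (T k (S k))) x := by
    induction n with
    | zero => simp [S, s₀]
    | succ n ih =>
      rw [hS n]
      funext x
      rw [Finset.sum_range_succ, Stage.next]
      simp only
      rw [ih]
  refine ⟨fun n => T n (S n), fun n => d n (S n), ⟨fun n => hnT _ _, fun n => h1T _ _,
    fun n => hsl _ _, fun n => ?_, fun n => (hsub n (S n)).trans (S n).2.subset, fun n => ?_,
    fun n => ?_, fun n => ?_⟩⟩
  · have := hht (n + 1) (S (n + 1))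
    rwa [hS n] at this
  · have := hsub (n + 1) (S (n + 1))
    rw [hS n] at this
    exact this
  · rw [← hb n]
    exact (S n).2.isBump.mono hL (mul_le_of_le_one_right hM.le (sub_le_self _ (by positivity)))
  · rw [← hb n]
    exact hun n (S n)

section

variable {a c₂ L M r : ℝ} {g ψ : ℝ → ℝ} {φ : ℕ → Policy} {m : ℕ} {ζ : ℝ} {T : ℕ → ℕ} {c : ℕ → ℝ}

/-- The superposition of all bumps. -/
noncomputable def totalBump (ψ : ℝ → ℝ) (m : ℕ) (ζ : ℝ) (T : ℕ → ℕ) (c : ℕ → ℝ) (x : ℝ) : ℝ :=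
  ∑' k, bump ψ (c k) (width m (T k)) (height m ζ (T k)) x

namespace IsNested

variable (hN : IsNested a c₂ L M r g ψ φ m ζ T c) (hψ : IsProfile L ψ)
include hN

theorem width_pos (n : ℕ) : 0 < width m (T n) := Pricing.width_pos (hN.one_le_horizon n)

theorem height_pos (n : ℕ) : 0 < height m ζ (T n) := Pricing.height_pos (hN.one_le_horizon n)

theorem tendsto_horizon : Tendsto T atTop atTop :=
  tendsto_atTop_mono hN.le_horizon tendsto_id

theorem summable_height : Summable fun n => height m ζ (T n) := by
  refine Summable.of_nonneg_of_le (fun n => (hN.height_pos n).le)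
    (fun n => (height_le_slack (hN.one_le_horizon n)).trans (hN.slack_le n)) ?_
  exact ((summable_nat_add_iff 1).2 summable_geometric_two).mul_left M

theorem support_antitone : Antitone fun n =>
    Set.Icc (c n - 2 * width m (T n)) (c n + 2 * width m (T n)) :=
  antitone_nat_of_succ_le fun n => (hN.subset_succ n).trans <|
    Set.Icc_subset_Icc (by linarith [hN.width_pos n]) (by linarith [hN.width_pos n])

theorem exists_mem :
    ∃ x ∈ Set.Icc a c₂, ∀ n, x ∈ Set.Icc (c n - width m (T n)) (c n + width m (T n)) := by
  obtain ⟨x, hx⟩ := IsCompact.nonempty_iInter_of_sequence_nonempty_isCompact_isClosed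
    (fun n => Set.Icc (c n - 2 * width m (T n)) (c n + 2 * width m (T n)))
    (fun n => hN.support_antitone n.le_succ)
    (fun n => Set.nonempty_Icc.2 (by linarith [hN.width_pos n])) isCompact_Icc
    fun n => isClosed_Icc
  rw [Set.mem_iInter] at hx
  exact ⟨x, hN.subset 0 (hx 0), fun n => hN.subset_succ n (hx (n + 1))⟩

include hψ

theorem summable_bump (x : ℝ) :
    Summable fun k => bump ψ (c k) (width m (T k)) (height m ζ (T k)) x :=
  Summable.of_nonneg_of_le (fun k => hψ.bump_nonneg (hN.height_pos k).le)
    (fun k => hψ.bump_le (hN.height_pos k).le) hN.summable_height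

theorem isBump_totalBump : IsBump a c₂ L M (totalBump ψ m ζ T c) :=
  IsBump.of_tendsto hN.isBump fun x => (hN.summable_bump hψ x).hasSum.tendsto_sum_nat

theorem contDiff_totalBump : ContDiff ℝ m (totalBump ψ m ζ T c) := by
  choose A hA using hψ.bounded
  refine contDiff_tsum (v := fun k i => M * (1 / 2) ^ (i + 1) * A k)
    (fun i => hψ.contDiff_bump m) (fun k _ => ?_) fun k i x hk => ?_
  · exact (((summable_nat_add_iff 1).2 summable_geometric_two).mul_left M).mul_right _
  · have hk : k ≤ m := by exact_mod_cast hk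
    have hw := hN.width_pos i
    have hA0 : 0 ≤ A k := (norm_nonneg _).trans (hA k 0)
    have hs := slack_pos (ζ := ζ) (hN.one_le_horizon i)
    refine (hψ.norm_iteratedFDeriv_bump_le hw (hN.height_pos i).le (hA k)).trans ?_
    rw [← mul_assoc]
    refine mul_le_mul_of_nonneg_right ?_ hA0
    refine le_trans ?_ (hN.slack_le i)
    have e : height m ζ (T i) * (width m (T i))⁻¹ ^ k
        = width m (T i) ^ (m - k) * slack ζ (T i) := by
      rw [height, ← Nat.sub_add_cancel hk, pow_add, Nat.sub_add_cancel hk]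
      field_simp
      rw [one_div, inv_pow, mul_inv_cancel₀ (pow_pos hw k).ne']
    rw [e]
    exact mul_le_of_le_one_left hs.le
      (pow_le_one₀ hw.le (width_le_one (hN.one_le_horizon i)))

theorem totalBump_eq_sum {n : ℕ} {x : ℝ}
    (hx : x ∉ Set.Icc (c n - 2 * width m (T n)) (c n + 2 * width m (T n))) :
    totalBump ψ m ζ T c x =
      ∑ k ∈ Finset.range n, bump ψ (c k) (width m (T k)) (height m ζ (T k)) x := by
  refine tsum_eq_sum fun k hk => ?_
  rw [Finset.mem_range, not_lt] at hk
  exact hψ.bump_eq_zero (hN.width_pos k) fun h => hx (hN.support_antitone hk h)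

theorem sum_le_totalBump (n : ℕ) (x : ℝ) :
    ∑ k ∈ Finset.range n, bump ψ (c k) (width m (T k)) (height m ζ (T k)) x ≤
      totalBump ψ m ζ T c x :=
  (hN.summable_bump hψ x).sum_le_tsum _ fun k _ => hψ.bump_nonneg (hN.height_pos k).le

theorem totalBump_le (n : ℕ) (x : ℝ) : totalBump ψ m ζ T c x ≤
    ∑ k ∈ Finset.range n, bump ψ (c k) (width m (T k)) (height m ζ (T k)) x
      + 2 * height m ζ (T n) := by
  have hh (k : ℕ) : height m ζ (T (k + n)) ≤ height m ζ (T n) * (1 / 2) ^ k := by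
    induction k with
    | zero => simp
    | succ k ih =>
      have := hN.height_succ_le (k + n)
      rw [add_right_comm, pow_succ]
      linarith
  rw [totalBump, ← (hN.summable_bump hψ x).sum_add_tsum_nat_add n]
  gcongr
  refine ((((summable_nat_add_iff n).2 (hN.summable_bump hψ x)).tsum_le_tsum
    (fun k => (hψ.bump_le (hN.height_pos _).le).trans (hh k))
    (summable_geometric_two.mul_left _))).trans_eq ?_
  rw [tsum_mul_left, tsum_geometric_two, mul_comm]

variable {x : ℝ} (hx : ∀ n, x ∈ Set.Icc (c n - width m (T n)) (c n + width m (T n)))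
include hx

theorem bump_eq (n : ℕ) :
    bump ψ (c n) (width m (T n)) (height m ζ (T n)) x = height m ζ (T n) :=
  hψ.bump_eq (hN.width_pos n) (hx n)

theorem totalBump_lt {y : ℝ} (hy : y ≠ x) :
    totalBump ψ m ζ T c y < totalBump ψ m ζ T c x := by
  obtain ⟨n, hn⟩ : ∃ n, y ∉ Set.Icc (c n - width m (T n)) (c n + width m (T n)) := by
    by_contra! hall
    refine hy (sub_eq_zero.1 (abs_nonpos_iff.1 ?_))
    have ht : Tendsto (fun n => 2 * width m (T n)) atTop (𝓝 (2 * 0)) :=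
      ((tendsto_width m).comp hN.tendsto_horizon).const_mul 2
    rw [mul_zero] at ht
    refine ge_of_tendsto' ht fun n => ?_
    have h1 := hall n
    have h2 := hx n
    rw [abs_le]
    constructor <;> linarith [h1.1, h1.2, h2.1, h2.2]
  refine Summable.tsum_lt_tsum (i := n + 1) (fun k => ?_) ?_ (hN.summable_bump hψ y)
    (hN.summable_bump hψ x)
  · rw [hN.bump_eq hψ hx k]
    exact hψ.bump_le (hN.height_pos k).le
  · rw [hN.bump_eq hψ hx, hψ.bump_eq_zero (hN.width_pos _) fun h => hn (hN.subset_succ n h)]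
    exact hN.height_pos _

theorem totalBump_add_height_le {n : ℕ} {y : ℝ}
    (hy : y ∉ Set.Icc (c n - 2 * width m (T n)) (c n + 2 * width m (T n))) :
    totalBump ψ m ζ T c y + height m ζ (T n) ≤ totalBump ψ m ζ T c x := by
  refine le_trans ?_ (hN.sum_le_totalBump hψ (n + 1) x)
  rw [hN.totalBump_eq_sum hψ hy, Finset.sum_range_succ, hN.bump_eq hψ hx n]
  gcongr with k
  rw [hN.bump_eq hψ hx k]
  exact hψ.bump_le (hN.height_pos k).le

end IsNested

end

theorem measurable_revenue (ν : Measure ℝ) : Measurable (revenue ν) := by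
  have := (monotone_cdf ν).measurable
  unfold revenue
  fun_prop

theorem revenue_nonneg (ν : Measure ℝ) (p : ℝ≥0) : 0 ≤ revenue ν p :=
  mul_nonneg p.2 (sub_nonneg.2 (cdf_le_one ν _))

/-- If every price off `J` loses at least `ε`, then so does, on average, every round in which the
price is not in `J`. -/
theorem le_expectedRegret (φ : Policy) (ν : Measure ℝ) (n : ℕ) {J : Set ℝ} (hJ : MeasurableSet J)
    {R ε : ℝ} (hR : ∀ p : ℝ≥0, revenue ν p ≤ R) {q : ℝ≥0} (hq : revenue ν q = R)
    (hε : ∀ p : ℝ≥0, (p : ℝ) ∉ J → revenue ν p + ε ≤ R) :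
    ε * (n - ∫ h, visits J h ∂law φ ν n) ≤ expectedRegret φ ν n := by
  have hopt : optimalRevenue ν = R :=
    le_antisymm (ciSup_le hR) (hq ▸ le_ciSup (f := fun p : ℝ≥0 => revenue ν p)
      ⟨R, by rintro _ ⟨p, rfl⟩; exact hR p⟩ q)
  have hV := integrable_visits hJ (law φ ν n)
  have e : ε * (n - ∫ h, visits J h ∂law φ ν n) = ∫ h, ε * ((n : ℝ) - visits J h) ∂law φ ν n := by
    rw [integral_const_mul, integral_sub (integrable_const _) hV]
    simp
  rw [e, expectedRegret, hopt]
  refine integral_mono (((integrable_const _).sub hV).const_mul ε)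
    (integrable_of_abs_le (C := n * R) ?_ fun h => ?_) fun h => ?_
  · have := measurable_revenue ν
    fun_prop
  · refine (Finset.abs_sum_le_sum_abs _ _).trans
      ((Finset.sum_le_sum (g := fun _ => R) fun t _ => ?_).trans (by simp))
    have h1 := hR (h t).1
    have h2 := revenue_nonneg ν (h t).1
    rw [abs_le]
    constructor <;> linarith
  · have e1 : (n : ℝ) - visits J h = ∑ t, (1 - J.indicator 1 ((h t).1 : ℝ)) := by
      simp [visits]
    simp only [e1, Finset.mul_sum]
    refine Finset.sum_le_sum fun t _ => ?_
    by_cases ht : ((h t).1 : ℝ) ∈ J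
    · simpa [ht] using hR (h t).1
    · have := hε _ ht
      simp only [ht, not_false_eq_true, Set.indicator_of_notMem, sub_zero, mul_one]
      linarith

end Pricing

/-- `φ T` is the policy that the seller uses when the number of rounds is `T`, so that policies
which know the horizon are covered; a policy which does not is a constant family. -/
theorem mainTheorem2 (m : ℕ) (hm : 1 ≤ m) (c₁ c₂ : ℝ) (hc : c₁ < c₂) (hc₂ : 0 < c₂)
    (ζ : ℝ) (hζ : 0 < ζ) (φ : ℕ → Pricing.Policy) :
    ∃ ν : Measure ℝ, IsProbabilityMeasure ν ∧ Pricing.IsMarket m c₁ c₂ ν ∧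
      ¬ (fun T : ℕ => Pricing.expectedRegret (φ T) ν T) =O[atTop]
        fun T : ℕ => (T : ℝ) ^ (((m : ℝ) + 1) / (2 * (m : ℝ) + 1) - ζ) := by
  obtain ⟨a, ha, hac⟩ := exists_between (max_lt hc hc₂)
  obtain ⟨hca, ha⟩ := max_lt_iff.1 ha
  obtain ⟨a', ha', hac'⟩ := exists_between hac
  obtain ⟨r, g, hg⟩ := Pricing.exists_isScale ha
  obtain ⟨L, ψ, hL, hψ⟩ := Pricing.exists_isProfile
  have hr := hg.pos
  obtain ⟨M, hM, hLM, hMa⟩ : ∃ M : ℝ, 0 < M ∧ L * M * c₂ ≤ 1 ∧ a * (1 + M) < a' := by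
    refine ⟨min (1 / ((L + 1) * c₂)) ((a' - a) / (2 * a)), lt_min (by positivity)
      (div_pos (by linarith) (by positivity)), ?_, ?_⟩
    · have h1 := min_le_left (1 / ((L + 1) * c₂)) ((a' - a) / (2 * a))
      rw [le_div_iff₀ (by positivity)] at h1
      have h2 : 0 ≤ min (1 / ((L + 1) * c₂)) ((a' - a) / (2 * a)) :=
        le_min (by positivity) (div_nonneg (by linarith) (by positivity))
      nlinarith [mul_nonneg h2 hc₂.le]
    · have h1 := min_le_right (1 / ((L + 1) * c₂)) ((a' - a) / (2 * a))
      rw [le_div_iff₀ (by positivity)] at h1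
      linarith
  obtain ⟨δ, hδ, hδr, hδa⟩ : ∃ δ : ℝ, 0 < δ ∧ δ * c₂ ≤ r ∧ a * (1 + M) ≤ (1 - δ) * a' := by
    have ha'0 := ha.trans ha'
    refine ⟨min (r / c₂) ((a' - a * (1 + M)) / a'), lt_min (by positivity)
      (div_pos (by linarith) ha'0), ?_, ?_⟩
    · rw [← le_div_iff₀ hc₂]
      exact min_le_left _ _
    · have h1 := min_le_right (r / c₂) ((a' - a * (1 + M)) / a')
      rw [le_div_iff₀ ha'0] at h1
      linarith
  obtain ⟨T, c, hN⟩ := Pricing.exists_isNested ha ha' hac' hg hψ hLM hL hM hδ hδr hδa φ hm hζ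
  have hb := hN.isBump_totalBump hψ
  obtain ⟨ν, hνp, hν⟩ := Pricing.exists_hasDemand ha ha' hg hb hLM hL hM.le
  obtain ⟨x, hxI, hx⟩ := hN.exists_mem
  have hx0 : 0 < x := (ha.trans ha').trans_le hxI.1
  have hrx : Pricing.revenue ν x = r * (1 + Pricing.totalBump ψ m ζ T c x) := by
    rw [hν.revenue_eq, hg.eq_self x (ha'.le.trans hxI.1), div_self hx0.ne', mul_one]
  have hlt (y : ℝ) (hy : y ≠ x) : Pricing.revenue ν y < Pricing.revenue ν x := by
    rw [hrx]
    refine (hν.revenue_le hg hb.nonneg y).trans_lt ?_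
    have := hN.totalBump_lt hψ hx hy
    gcongr
  refine ⟨ν, hνp, ⟨hν.timesDifferentiableOn hg (hN.contDiff_totalBump hψ) hc,
    x, ⟨hca.le.trans (ha'.le.trans hxI.1), hxI.2⟩, hlt⟩, fun hO => ?_⟩
  have hreg (n : ℕ) : r / 4 * (T n * Pricing.height m ζ (T n)) ≤
      Pricing.expectedRegret (φ (T n)) ν (T n) := by
    have hh := hN.height_pos n
    have h1 := hN.unnoticed n ν _ hν (fun y hy => hN.totalBump_eq_sum hψ hy)
      fun y => ⟨hN.sum_le_totalBump hψ n y, hN.totalBump_le hψ n y⟩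
    have h2 := Pricing.le_expectedRegret (φ (T n)) ν (T n)
      (J := Set.Icc (c n - 2 * Pricing.width m (T n)) (c n + 2 * Pricing.width m (T n)))
      measurableSet_Icc (R := Pricing.revenue ν x) (ε := r * Pricing.height m ζ (T n))
      (fun p => ?_) (q := ⟨x, hx0.le⟩) rfl fun p hp => ?_
    · refine le_trans ?_ h2
      have h3 : 0 ≤ r * Pricing.height m ζ (T n) := by positivity
      have h4 := mul_le_mul_of_nonneg_left h1 h3
      linarith
    · rcases eq_or_ne (p : ℝ) x with h | h
      · rw [h]
      · exact (hlt p h).le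
    · have h3 := hν.revenue_le hg hb.nonneg p
      have h4 := mul_le_mul_of_nonneg_left (hN.totalBump_add_height_le hψ hx hp) hr.le
      rw [hrx]
      linarith
  obtain ⟨C, hC⟩ := (hO.comp_tendsto hN.tendsto_horizon).bound
  have htend : Tendsto (fun n => r / 4 * (T n : ℝ) ^ (ζ / 2)) atTop atTop :=
    ((tendsto_rpow_atTop (by positivity)).comp
      (tendsto_natCast_atTop_atTop.comp hN.tendsto_horizon)).const_mul_atTop (by positivity)
  obtain ⟨n, hn, hn'⟩ := (hC.and (htend.eventually_gt_atTop C)).exists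
  have hT := hN.one_le_horizon n
  have hT0 : (0 : ℝ) < T n := by exact_mod_cast hT
  have h1 := hreg n
  rw [Pricing.mul_height hT] at h1
  have h2 : 0 < (T n : ℝ) ^ (((m : ℝ) + 1) / (2 * (m : ℝ) + 1) - ζ) := Real.rpow_pos_of_pos hT0 _
  simp only [Function.comp, Real.norm_of_nonneg h2.le] at hn
  have h3 := (le_abs_self _).trans hn
  have h4 := mul_lt_mul_of_pos_right hn' h2
  linarith
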